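/- Let $F=F(X)$ be the free group on a finite set $X$, and let $|w|$ denote the length of the reduced word representing $w\in F$. For $R\subseteq F$ and $k\ge 0$ put $f_k(R)=|R\cap S_k|/|S_k|$, where $S_k=\{w\in F : |w|=k\}$; the set $R$ is called \emph{exponentially negligible} in $F$ if there is a constant $0<\delta<1$ such that $f_k(R)<\delta^k$ for all sufficiently large $k$. Let $C\le F$ be a subgroup. A \emph{Schreier transversal} of $C$ is a set $S\subseteq F$ containing exactly one element of each right coset $Cg$, $g\in F$, and such that every initial segment of the reduced word of an element of $S$ again represents an element of $S$. For such an $S$ define the set of singular representatives $$S_{\rm sin}=\{s\in S : s^{-1}Cs\cap C\neq 1\}$$ and the set of unstable representatives $$S_{\rm uns}=\{s\in S : sc\notin S \text{ for some } c\in C\}.$$ If $C$ is finitely generated and of infinite index in $F$, then both sets $$\mathrm{Sin}(C)=\bigcup_S S_{\rm sin},\qquad \mathrm{Uns}(C)=\bigcup_S S_{\rm uns},$$ where $S$ runs over all Schreier transversals of $C$, are exponentially negligible in $F$. -/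

import Mathlib

namespace FreeGroupDensity

variable {α : Type*} [DecidableEq α]

/-- The sphere of radius `k` in the free group on `α`: the elements whose reduced word has
length `k`. -/
def sphere (α : Type*) [DecidableEq α] (k : ℕ) : Set (FreeGroup α) :=
  {w | w.norm = k}

/-- The frequency of elements of `R` among the reduced words of length `k`. Over a finite
nonempty alphabet every sphere is finite and nonempty, so this is an honest ratio. -/
noncomputable def frequency (R : Set (FreeGroup α)) (k : ℕ) : ℝ :=
  ((R ∩ sphere α k).ncard : ℝ) / ((sphere α k).ncard : ℝ)

/-- `R` is exponentially negligible: for some positive `δ < 1`, the frequencies are less than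
`δ ^ k` for all sufficiently large `k`. -/
def ExponentiallyNegligible (R : Set (FreeGroup α)) : Prop :=
  ∃ δ : ℝ, 0 < δ ∧ δ < 1 ∧ ∃ N : ℕ, ∀ k ≥ N, frequency R k < δ ^ k

/-- A Schreier transversal of `C`: a set `S` containing exactly one element of each right coset
`C g` (every `g` is uniquely `c * s` with `c ∈ C`, `s ∈ S`), and containing every initial segment
of the reduced word of each of its elements. -/
def IsSchreierTransversal (C : Subgroup (FreeGroup α)) (S : Set (FreeGroup α)) : Prop :=
  Subgroup.IsComplement (C : Set (FreeGroup α)) S ∧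
    ∀ s ∈ S, ∀ p : List (α × Bool), p <+: s.toWord → FreeGroup.mk p ∈ S

/-- The generalized normalizer `{f | f⁻¹ C f ∩ C ≠ 1}`. -/
def generalizedNormalizer {G : Type*} [Group G] (C : Subgroup G) : Set G :=
  {f | C.map (MulAut.conj f⁻¹).toMonoidHom ⊓ C ≠ ⊥}

/-- The singular elements of `S`. -/
def singularPart {G : Type*} [Group G] (C : Subgroup G) (S : Set G) : Set G :=
  {s | s ∈ S ∧ s ∈ generalizedNormalizer C}

/-- The stable elements of `S`. -/
def stablePart {G : Type*} [Group G] (C : Subgroup G) (S : Set G) : Set G :=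
  {s | s ∈ S ∧ ∀ c ∈ C, s * c ∈ S}

/-- The unstable elements of `S`. -/
def unstablePart {G : Type*} [Group G] (C : Subgroup G) (S : Set G) : Set G :=
  S \ stablePart C S

/-- The union of the singular parts of all Schreier transversals of `C`. -/
def Sin (C : Subgroup (FreeGroup α)) : Set (FreeGroup α) :=
  ⋃ S ∈ {S : Set (FreeGroup α) | IsSchreierTransversal C S}, singularPart C S

/-- The union of the unstable parts of all Schreier transversals of `C`. -/
def Uns (C : Subgroup (FreeGroup α)) : Set (FreeGroup α) :=
  ⋃ S ∈ {S : Set (FreeGroup α) | IsSchreierTransversal C S}, unstablePart C S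

end FreeGroupDensity

/-! ### Cancellation in reduced words -/

namespace FreeGroupDensity

open FreeGroup

/-! The set `corePrefixes C` consists of the words readable from the base vertex of the Stallings
core of `C`. It is prefix-closed and a union of right cosets of `C`, finitely many when `C` is
finitely generated (`finite_cosets_corePrefixes`).

Cut a representative `s` after its longest prefix `p` in the core. The prefixes of `p` all lie in
the transversal, hence in distinct core cosets, so `p` has bounded length. If the rest `q` is
nonempty and `q⁻¹` is not a core prefix, then multiplying `s` by elements of `C` on either side
leaves the exit from the core visible (`exists_toWord_mul_mul_eq`), and `s` is neither singular nor
unstable. So singular and unstable representatives are a short word followed by the inverse of a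
core prefix (`exists_union_subset_shortTimesCore`).

Inverses of core prefixes form a suffix-closed set `Q`, a union of finitely many left cosets, proper
because the index is infinite. Every nonempty reduced word in `Q` leaves `Q` under some left
extension of bounded length (`exists_extension_length_bound`), so a fixed proportion of `Q` is lost
every few letters. This gives exponential decay, and the boundedly many cut positions cost only a
constant factor. -/

theorem isReduced_append_or {α : Type*} {u v : List (α × Bool)} (hu : FreeGroup.IsReduced u)
    (hv : FreeGroup.IsReduced v) :
    FreeGroup.IsReduced (u ++ v) ∨ ∃ a x b, u = a ++ [x] ∧ v = (x.1, !x.2) :: b := by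
  by_cases h : FreeGroup.IsReduced (u ++ v)
  · exact Or.inl h
  · right
    have h' : ¬ ∀ x ∈ u.getLast?, ∀ y ∈ v.head?, x.1 = y.1 → x.2 = y.2 := fun H =>
      h (List.isChain_append.2 ⟨hu, hv, H⟩)
    push Not at h'
    obtain ⟨x, hx, y, hy, h1, h2⟩ := h'
    obtain ⟨a, rfl⟩ := List.getLast?_eq_some_iff.1 hx
    obtain ⟨b, rfl⟩ := List.head?_eq_some_iff.1 hy
    refine ⟨a, x, b, rfl, ?_⟩
    obtain ⟨y1, y2⟩ := y
    obtain ⟨x1, x2⟩ := x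
    cases x2 <;> cases y2 <;> simp_all

theorem not_isReduced_cancel {α : Type*} (a b : List (α × Bool)) (x : α × Bool) :
    ¬ FreeGroup.IsReduced (a ++ [x] ++ (x.1, !x.2) :: b) := by
  intro h
  have := h.infix (L₁ := [x, (x.1, !x.2)]) ⟨a, b, by simp⟩
  simp [FreeGroup.IsReduced] at this

theorem prefix_append_or {β : Type*} {p u v : List β} (h : p <+: u ++ v) :
    p <+: u ∨ ∃ w, p = u ++ w ∧ w <+: v := by
  obtain ⟨t, ht⟩ := h
  rcases List.append_eq_append_iff.1 ht with ⟨z, h1, -⟩ | ⟨z, h1, h2⟩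
  · exact Or.inl ⟨z, h1.symm⟩
  · exact Or.inr ⟨z, h1, t, h2.symm⟩

theorem exists_cancellation {α : Type*} {u : List (α × Bool)} (hu : FreeGroup.IsReduced u) :
    ∀ {v : List (α × Bool)}, FreeGroup.IsReduced v →
      ∃ a b d, u = a ++ b ∧ v = invRev b ++ d ∧ FreeGroup.IsReduced (a ++ d) := by
  induction u using List.reverseRecOn with
  | nil => exact fun {v} hv => ⟨[], [], v, by simp, by simp, by simpa⟩
  | append_singleton u x ih =>
    intro v hv
    rcases isReduced_append_or hu hv with h | ⟨a, y, b, h1, rfl⟩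
    · exact ⟨u ++ [x], [], v, by simp, by simp, h⟩
    · obtain ⟨rfl, h1⟩ := List.append_inj' h1 rfl
      obtain rfl : x = y := by simpa using h1
      obtain ⟨a', b', d, rfl, rfl, h⟩ := ih (hu.infix ⟨[], [x], by simp⟩)
        (v := b) (hv.infix ⟨[(x.1, !x.2)], [], by simp⟩)
      exact ⟨a', b' ++ [x], d, by simp, by simp [invRev], h⟩

/-! ### Core prefixes and the point where a word leaves the core -/

variable {α : Type*} [DecidableEq α]

theorem toWord_mk_of_isReduced {w : List (α × Bool)} (h : FreeGroup.IsReduced w) : (mk w).toWord = w := by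
  rw [toWord_mk, h.reduce_eq]

theorem isReduced_of_prefix {p : List (α × Bool)} {g : FreeGroup α} (h : p <+: g.toWord) :
    FreeGroup.IsReduced p :=
  isReduced_toWord.infix h.isInfix

theorem toWord_mul_of_isReduced {g h : FreeGroup α} (H : FreeGroup.IsReduced (g.toWord ++ h.toWord)) :
    (g * h).toWord = g.toWord ++ h.toWord := by
  rw [toWord_mul, H.reduce_eq]

/-- The elements represented by initial segments of reduced words of elements of `C`. -/
def corePrefixes (C : Subgroup (FreeGroup α)) : Set (FreeGroup α) :=
  {g | ∃ c ∈ C, g.toWord <+: c.toWord}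

variable {C : Subgroup (FreeGroup α)}

theorem mem_corePrefixes_of_mem {g : FreeGroup α} (h : g ∈ C) : g ∈ corePrefixes C :=
  ⟨g, h, List.prefix_rfl⟩

theorem mk_mem_corePrefixes_of_prefix {g : FreeGroup α} {p : List (α × Bool)}
    (hg : g ∈ corePrefixes C) (hp : p <+: g.toWord) : mk p ∈ corePrefixes C := by
  obtain ⟨c, hc, h⟩ := hg
  exact ⟨c, hc, by rw [toWord_mk_of_isReduced (isReduced_of_prefix hp)]; exact hp.trans h⟩

/-- Let `g u = d` be reduced with `d ∈ C`. If nothing cancels between `c g` and `u`, then `c g`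
begins `c d`; if nothing cancels between `c g` and `g⁻¹`, it begins `c`. If both cancel, the last
letter of `g` is inverse to the first of `u`, which is impossible. -/
theorem mul_mem_corePrefixes {c g : FreeGroup α} (hc : c ∈ C) (hg : g ∈ corePrefixes C) :
    c * g ∈ corePrefixes C := by
  obtain ⟨d, hd, u, hu⟩ := hg
  have hred : FreeGroup.IsReduced (g.toWord ++ u) := hu ▸ isReduced_toWord
  have hured : FreeGroup.IsReduced u := hred.infix ⟨g.toWord, [], by simp⟩
  have hdu : g * mk u = d := by rw [← mk_toWord (x := d), ← hu, ← mul_mk, mk_toWord]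
  rcases isReduced_append_or (isReduced_toWord (x := c * g)) hured with h | ⟨a, x, b, h1, h2⟩
  · refine ⟨c * g * mk u, ?_, u, ?_⟩
    · rw [mul_assoc, hdu]; exact C.mul_mem hc hd
    · have := toWord_mk_of_isReduced hured
      rw [toWord_mul_of_isReduced (g := c * g) (by rwa [this]), this]
  rcases isReduced_append_or (isReduced_toWord (x := c * g)) (isReduced_toWord (x := g⁻¹)) with
    h | ⟨a', x', b', h1', h2'⟩
  · refine ⟨c * g * g⁻¹, by simpa using hc, (g⁻¹).toWord, ?_⟩
    rw [toWord_mul_of_isReduced h]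
  · exfalso
    rw [h1] at h1'
    obtain ⟨rfl, h3⟩ := List.append_inj' h1' rfl
    obtain rfl : x = x' := by simpa using h3
    have h4 : g.toWord = invRev b' ++ [x] := by
      rw [← invRev_invRev (L₁ := g.toWord), ← toWord_inv, h2']
      simp [invRev]
    rw [h4, h2] at hred
    exact not_isReduced_cancel _ _ _ hred

theorem mul_mem_corePrefixes_iff {c g : FreeGroup α} (hc : c ∈ C) :
    c * g ∈ corePrefixes C ↔ g ∈ corePrefixes C :=
  ⟨fun h => by simpa using mul_mem_corePrefixes (C.inv_mem hc) h, mul_mem_corePrefixes hc⟩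

/-- A prefix of `c d` is a prefix of `c` or `c` times a prefix of `d`, and a prefix of `c⁻¹` is
`c⁻¹` times a prefix of `c`. Up to left multiplication by `C`, only prefixes of generators remain.
-/
theorem corePrefixes_subset_of_closure {A : Set (FreeGroup α)} (hA : Subgroup.closure A = C)
    {g : FreeGroup α} (hg : g ∈ corePrefixes C) :
    ∃ c ∈ C, ∃ p, (p = [] ∨ ∃ a ∈ A, p <+: a.toWord) ∧ g = c * mk p := by
  set V : Set (FreeGroup α) :=
    {g | ∃ c ∈ C, ∃ p, (p = [] ∨ ∃ a ∈ A, p <+: a.toWord) ∧ g = c * mk p} with hV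
  have hmul : ∀ c ∈ C, ∀ v ∈ V, c * v ∈ V := by
    rintro c hc v ⟨d, hd, p, hp, rfl⟩
    exact ⟨c * d, C.mul_mem hc hd, p, hp, by group⟩
  have hsub : ∀ c ∈ Subgroup.closure A, c ∈ C ∧ ∀ p, p <+: c.toWord → mk p ∈ V := by
    intro c hc
    induction hc using Subgroup.closure_induction with
    | mem a ha =>
      exact ⟨hA ▸ Subgroup.subset_closure ha, fun p hp =>
        ⟨1, C.one_mem, p, Or.inr ⟨a, ha, hp⟩, by simp⟩⟩
    | one =>
      refine ⟨C.one_mem, fun p hp => ⟨1, C.one_mem, p, Or.inl ?_, by simp⟩⟩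
      simpa using hp
    | mul c d _ _ hc hd =>
      refine ⟨C.mul_mem hc.1 hd.1, fun p hp => ?_⟩
      obtain ⟨a, b, e, h1, h2, h3⟩ := exists_cancellation (isReduced_toWord (x := c))
        (isReduced_toWord (x := d))
      have h4 : c * d = mk (a ++ e) := by
        rw [← mk_toWord (x := c), ← mk_toWord (x := d), h1, h2, ← mul_mk, ← mul_mk, ← mul_mk,
          ← inv_mk]
        group
      rw [h4, toWord_mk_of_isReduced h3] at hp
      rcases prefix_append_or hp with hp | ⟨e', rfl, he'⟩
      · exact hc.2 p (hp.trans ⟨b, h1.symm⟩)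
      · have h5 : mk (a ++ e') = c * mk (invRev b ++ e') := by
          rw [← mk_toWord (x := c), h1, ← mul_mk, ← mul_mk, ← mul_mk, ← inv_mk]
          group
        rw [h5]
        refine hmul c hc.1 _ (hd.2 _ ?_)
        rw [h2]
        exact (List.prefix_append_right_inj _).2 he'
    | inv c _ hc =>
      refine ⟨C.inv_mem hc.1, ?_⟩
      rintro p ⟨r, hr⟩
      have h1 : c.toWord = invRev r ++ invRev p := by
        rw [← invRev_append, hr, toWord_inv, invRev_invRev]
      have h2 : mk p = c⁻¹ * mk (invRev r) := by
        rw [← mk_toWord (x := c), h1, ← mul_mk, ← inv_mk, ← inv_mk]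
        group
      rw [h2]
      exact hmul _ (C.inv_mem hc.1) _ (hc.2 _ ⟨_, h1.symm⟩)
  obtain ⟨c, hc, hp⟩ := hg
  have := (hsub c (hA ▸ hc)).2 _ hp
  rwa [mk_toWord] at this

/-- Inversion turns the right coset `C g` into the left coset `g⁻¹ C`, the kind that `⧸` uses. -/
theorem finite_cosets_corePrefixes (hC : C.FG) :
    ((fun g : FreeGroup α => ((g⁻¹ : FreeGroup α) : FreeGroup α ⧸ C)) '' corePrefixes C).Finite := by
  obtain ⟨A, hA⟩ := hC
  have hfin : ({p : List (α × Bool) | p = [] ∨ ∃ a ∈ (A : Set (FreeGroup α)),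
      p <+: a.toWord}).Finite := by
    refine ((Set.finite_singleton []).union
      (A.finite_toSet.biUnion fun a _ => (List.finite_toSet a.toWord.inits))).subset ?_
    rintro p (rfl | ⟨a, ha, hp⟩)
    · simp
    · right
      simp only [Set.mem_iUnion]
      exact ⟨a, ha, (List.mem_inits _ _).2 hp⟩
  refine (hfin.image fun p => (((mk p)⁻¹ : FreeGroup α) : FreeGroup α ⧸ C)).subset ?_
  rintro _ ⟨g, hg, rfl⟩
  obtain ⟨c, hc, p, hp, rfl⟩ := corePrefixes_subset_of_closure hA hg
  refine ⟨p, hp, ?_⟩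
  simp only [mul_inv_rev]
  exact (QuotientGroup.mk_mul_of_mem _ (C.inv_mem hc)).symm

/-- The factor `d` cannot cancel all of `x :: q`, as its inverse would then begin `d`. The letter
`x` cannot cancel against `c p`, as `c p x` would then be a prefix of `c p`, hence in the core. The
tail `r` does not depend on `c`. -/
theorem exists_toWord_mul_mul_eq {s : FreeGroup α} {p q : List (α × Bool)} {x : α × Bool}
    (hs : s.toWord = p ++ x :: q) (hp : mk p ∈ corePrefixes C)
    (hpx : mk (p ++ [x]) ∉ corePrefixes C) (hq : (mk (x :: q))⁻¹ ∉ corePrefixes C)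
    {d : FreeGroup α} (hd : d ∈ C) :
    ∃ r, ∀ c ∈ C, (c * s * d).toWord = (c * mk p).toWord ++ x :: r := by
  obtain ⟨a, b, e, h1, h2, h3⟩ := exists_cancellation (isReduced_toWord (x := s))
    (isReduced_toWord (x := d))
  have h4 : s * d = mk (a ++ e) := by
    rw [← mk_toWord (x := s), ← mk_toWord (x := d), h1, h2, ← mul_mk, ← mul_mk, ← mul_mk,
      ← inv_mk]
    group
  obtain ⟨a', rfl⟩ : ∃ a', a = p ++ x :: a' := by
    rw [hs, List.append_eq_append_iff] at h1
    rcases h1 with ⟨t, h5, h6⟩ | ⟨t, h5, h6⟩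
    · cases t with
      | nil =>
        exfalso
        refine hq ⟨d, hd, ?_⟩
        have h7 : FreeGroup.IsReduced (x :: q) :=
          (isReduced_toWord (x := s)).infix ⟨p, [], by simp [hs]⟩
        rw [toWord_inv, toWord_mk_of_isReduced h7, h2, h6]
        simp
      | cons y t =>
        obtain ⟨rfl, -⟩ : x = y ∧ _ := by simpa using h6
        exact ⟨t, h5⟩
    · exfalso
      refine hq ⟨d, hd, ?_⟩
      have h7 : FreeGroup.IsReduced (x :: q) :=
        (isReduced_toWord (x := s)).infix ⟨p, [], by simp [hs]⟩
      rw [toWord_inv, toWord_mk_of_isReduced h7, h2, h6]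
      simp
  refine ⟨a' ++ e, fun c hc => ?_⟩
  have h5 : c * s * d = mk ((c * mk p).toWord ++ x :: (a' ++ e)) := by
    rw [mul_assoc, h4, ← mul_mk (L₁ := (c * mk p).toWord), mk_toWord, mul_assoc, mul_mk]
    simp
  rw [h5]
  refine toWord_mk_of_isReduced ?_
  rcases isReduced_append_or (isReduced_toWord (x := c * mk p)) (h3.infix
    (L₁ := x :: (a' ++ e)) ⟨p, [], by simp⟩) with h | ⟨u, y, v, h6, h7⟩
  · exact h
  · exfalso
    have hu : c * mk (p ++ [x]) = mk u := by
      obtain ⟨rfl, -⟩ : x = (y.1, !y.2) ∧ _ := by simpa using h7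
      rw [← mul_mk, ← mul_assoc, ← mk_toWord (x := c * mk p), h6, mul_mk]
      have : (Red.Step (u ++ y :: (y.1, !y.2) :: []) (u ++ [])) := Red.Step.not
      have h8 : mk (u ++ [y, (y.1, !y.2)]) = mk (u ++ []) := Quot.sound this
      simpa using h8
    refine hpx ((mul_mem_corePrefixes_iff hc).1 ?_)
    rw [hu]
    exact mk_mem_corePrefixes_of_prefix (mul_mem_corePrefixes hc hp) ⟨[y], h6.symm⟩

theorem exists_maximal_prefix {β : Type*} (P : List β → Prop) (w : List β) (h : P []) :
    ∃ p q, w = p ++ q ∧ P p ∧ (q = [] ∨ ∃ x r, q = x :: r ∧ ¬ P (p ++ [x])) := by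
  induction w using List.reverseRecOn with
  | nil => exact ⟨[], [], rfl, h, Or.inl rfl⟩
  | append_singleton w x ih =>
    obtain ⟨p, q, rfl, hp, rfl | ⟨y, r, rfl, hy⟩⟩ := ih
    · by_cases hx : P (p ++ [x])
      · exact ⟨p ++ [x], [], by simp, hx, Or.inl rfl⟩
      · exact ⟨p, [x], by simp, hp, Or.inr ⟨x, [], rfl, hx⟩⟩
    · exact ⟨p, y :: r ++ [x], by simp, hp, Or.inr ⟨y, r ++ [x], by simp, hy⟩⟩

/-- If one of `g`, `h` were longer, it would contain the exit letter of the other, against prefix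
closure of the core. -/
theorem eq_of_exit_eq {g h : FreeGroup α} {x y : α × Bool} {r t : List (α × Bool)}
    (hg : g ∈ corePrefixes C) (hh : h ∈ corePrefixes C)
    (hgx : g * mk [x] ∉ corePrefixes C) (hhy : h * mk [y] ∉ corePrefixes C)
    (e : g.toWord ++ x :: r = h.toWord ++ y :: t) : g = h := by
  have key : ∀ {g h : FreeGroup α} {x : α × Bool} {r t : List (α × Bool)},
      h ∈ corePrefixes C → g * mk [x] ∉ corePrefixes C →
      ∀ z, h.toWord = g.toWord ++ z → x :: r = z ++ t → z = [] := by
    intro g h x r t hh hgx z h1 h2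
    cases z with
    | nil => rfl
    | cons y z =>
      obtain ⟨rfl, -⟩ : x = y ∧ _ := by simpa using h2
      refine absurd (mk_mem_corePrefixes_of_prefix hh (p := g.toWord ++ [x])
        ⟨z, by simp [h1]⟩) ?_
      rwa [← mul_mk, mk_toWord]
  rw [List.append_eq_append_iff] at e
  rcases e with ⟨z, h1, h2⟩ | ⟨z, h1, h2⟩
  · have := key hh hgx z h1 h2
    subst this
    exact (toWord_injective (by simpa using h1)).symm
  · have := key hg hhy z h1 h2
    subst this
    exact toWord_injective (by simpa using h1)

/-- The `p.length + 1` prefixes of `p` lie in `S`, hence in distinct cosets, all of them in the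
core; `m` is the number of core cosets. -/
theorem exists_length_bound (hC : C.FG) :
    ∃ m : ℕ, ∀ S, IsSchreierTransversal C S → ∀ s ∈ S, ∀ p, p <+: s.toWord →
      mk p ∈ corePrefixes C → p.length < m := by
  have hfin := finite_cosets_corePrefixes hC
  refine ⟨hfin.toFinset.card, fun S hS s hs p hp hpC => ?_⟩
  have hpr := isReduced_of_prefix hp
  have : (Finset.range (p.length + 1)).card ≤ hfin.toFinset.card := by
    refine Finset.card_le_card_of_injOn
      (fun i => (((mk (p.take i))⁻¹ : FreeGroup α) : FreeGroup α ⧸ C)) ?_ ?_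
    · intro i _
      simp only [Set.Finite.coe_toFinset]
      refine ⟨mk (p.take i), mk_mem_corePrefixes_of_prefix hpC ?_, rfl⟩
      rw [toWord_mk_of_isReduced hpr]
      exact List.take_prefix i p
    · intro i hi j hj hij
      have hmem : ∀ i, mk (p.take i) ∈ S := fun i =>
        hS.2 s hs _ ((List.take_prefix i p).trans hp)
      have hc : mk (p.take i) * (mk (p.take j))⁻¹ ∈ C := by
        simpa using QuotientGroup.eq.1 hij
      have heq : mk (p.take i) = mk (p.take j) := by
        have := hS.1.1 (a₁ := (⟨_, hc⟩, ⟨_, hmem j⟩)) (a₂ := (⟨1, C.one_mem⟩, ⟨_, hmem i⟩))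
          (by simp only [one_mul, inv_mul_cancel_right])
        simpa using (congrArg (fun z => (z.2 : FreeGroup α)) this).symm
      have h2 := congrArg toWord heq
      rw [toWord_mk_of_isReduced (hpr.infix (List.take_prefix i p).isInfix),
        toWord_mk_of_isReduced (hpr.infix (List.take_prefix j p).isInfix)] at h2
      have h3 := congrArg List.length h2
      simp only [Finset.coe_range, Set.mem_Iio] at hi hj
      simp only [List.length_take] at h3
      omega
  simpa using this

/-- Otherwise a relation `c s = s y` with `c, y ∈ C` gives two words for one element, leaving the
core at `c p` and at `p`. These agree, so `c = 1` and `y = 1`. -/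
theorem inv_suffix_mem_of_singular {S : Set (FreeGroup α)} {s : FreeGroup α}
    (hs : s ∈ singularPart C S) {p q : List (α × Bool)} {x : α × Bool}
    (hw : s.toWord = p ++ x :: q) (hp : mk p ∈ corePrefixes C)
    (hpx : mk (p ++ [x]) ∉ corePrefixes C) : (mk (x :: q))⁻¹ ∈ corePrefixes C := by
  by_contra hq
  obtain ⟨⟨y, hy⟩, hy0⟩ := Subgroup.ne_bot_iff_exists_ne_one.1 hs.2
  have hy1 : y ≠ 1 := fun h => hy0 (Subtype.ext h)
  obtain ⟨⟨c, hc, hcy⟩, hyC⟩ := Subgroup.mem_inf.1 hy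
  have hcy' : s⁻¹ * c * s = y := by simpa using hcy
  have hcs : c * s = s * y := by rw [← hcy']; group
  obtain ⟨r, hr⟩ := exists_toWord_mul_mul_eq hw hp hpx hq C.one_mem
  obtain ⟨t, ht⟩ := exists_toWord_mul_mul_eq hw hp hpx hq hyC
  have hpr : mk p * mk [x] ∉ corePrefixes C := by rwa [mul_mk]
  have h := eq_of_exit_eq (C := C) (x := x) (y := x) (r := r) (t := t) (g := c * mk p)
    (h := 1 * mk p) (mul_mem_corePrefixes hc hp) (by simpa) (by
      rw [mul_assoc, mul_mem_corePrefixes_iff hc]; exact hpr) (by simpa using hpr) (by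
      rw [← hr c hc, ← ht 1 C.one_mem, mul_one, one_mul, hcs])
  have hc1 : c = 1 := mul_right_cancel h
  apply hy1
  rw [← hcy', hc1]
  group

/-- Otherwise let `s d = c t` with `t ∈ S`. The word of `t` begins with `c⁻¹ p`, so `c⁻¹ p` and `p`
both represent the same coset in `S`; hence `c = 1` and `s d ∈ S`. -/
theorem inv_suffix_mem_of_unstable {S : Set (FreeGroup α)} (hS : IsSchreierTransversal C S)
    {s : FreeGroup α} (hs : s ∈ unstablePart C S) {p q : List (α × Bool)} {x : α × Bool}
    (hw : s.toWord = p ++ x :: q) (hp : mk p ∈ corePrefixes C)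
    (hpx : mk (p ++ [x]) ∉ corePrefixes C) : (mk (x :: q))⁻¹ ∈ corePrefixes C := by
  by_contra hq
  refine hs.2 ⟨hs.1, fun d hd => ?_⟩
  obtain ⟨r, hr⟩ := exists_toWord_mul_mul_eq hw hp hpx hq hd
  obtain ⟨⟨⟨c, hc⟩, ⟨t, ht⟩⟩, hct⟩ := hS.1.2 (s * d)
  have hct' : c * t = s * d := hct
  have ht' : c⁻¹ * s * d = t := by rw [mul_assoc, ← hct']; group
  have hword := hr c⁻¹ (C.inv_mem hc)
  rw [ht'] at hword
  have h1 : c⁻¹ * mk p ∈ S := by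
    have := hS.2 t ht (c⁻¹ * mk p).toWord ⟨_, hword.symm⟩
    rwa [mk_toWord] at this
  have h2 : mk p ∈ S := hS.2 s hs.1 p ⟨_, hw.symm⟩
  have := hS.1.1 (a₁ := (⟨c, hc⟩, ⟨_, h1⟩)) (a₂ := (⟨1, C.one_mem⟩, ⟨_, h2⟩)) (by simp)
  have hc1 : c = 1 := by simpa using congrArg (fun z => (z.1 : FreeGroup α)) this
  rw [← hct', hc1, one_mul]
  exact ht

/-- The elements whose reduced word is a word of length less than `m` followed by a word whose
inverse is an initial segment of an element of `C`. -/
def shortTimesCore (C : Subgroup (FreeGroup α)) (m : ℕ) : Set (FreeGroup α) :=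
  {s | ∃ p q, s.toWord = p ++ q ∧ p.length < m ∧ (mk q)⁻¹ ∈ corePrefixes C}

theorem exists_union_subset_shortTimesCore (hC : C.FG) :
    ∃ m, Sin C ∪ Uns C ⊆ shortTimesCore C m := by
  obtain ⟨m, hm⟩ := exists_length_bound hC
  have h1 : (1 : FreeGroup α) ∈ corePrefixes C := mem_corePrefixes_of_mem C.one_mem
  refine ⟨m, ?_⟩
  rintro s (hs | hs)
  all_goals
    simp only [Sin, Uns, Set.mem_iUnion, Set.mem_ofPred_eq] at hs
    obtain ⟨S, hS, hs⟩ := hs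
    obtain ⟨p, q, hw, hp, hq⟩ := exists_maximal_prefix (fun p => mk p ∈ corePrefixes C) s.toWord h1
    refine ⟨p, q, hw, hm S hS s hs.1 p ⟨q, hw.symm⟩ hp, ?_⟩
    rcases hq with rfl | ⟨x, r, rfl, hx⟩
    · exact (by simpa using h1 : ((1 : FreeGroup α))⁻¹ ∈ corePrefixes C)
  · exact inv_suffix_mem_of_singular hs hw hp hx
  · exact inv_suffix_mem_of_unstable hS hs hw hp hx

end FreeGroupDensity

/-! ### Leaving a proper finite union of cosets by left extension -/

namespace FreeGroupDensity

open FreeGroup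

variable {α : Type*}

theorem isReduced_append_of_head?_eq {v w w' : List (α × Bool)} (h : FreeGroup.IsReduced (v ++ w))
    (hw' : FreeGroup.IsReduced w') (e : w.head? = w'.head?) : FreeGroup.IsReduced (v ++ w') := by
  have := List.isChain_append.1 h
  exact List.isChain_append.2 ⟨this.1, hw', e ▸ this.2.2⟩

theorem isReduced_alternating {x : α × Bool} {t : List (α × Bool)}
    (hw : FreeGroup.IsReduced (x :: t)) {a : α} (ha : a ≠ x.1) (k : ℕ) :
    FreeGroup.IsReduced
      ((List.replicate k [(x.1, !x.2), (a, true)]).flatten ++ x :: t) ∧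
    ∃ b r, (List.replicate k [(x.1, !x.2), (a, true)]).flatten ++ x :: t = (x.1, b) :: r := by
  induction k with
  | zero => exact ⟨by simpa using hw, x.2, t, by simp⟩
  | succ k ih =>
    obtain ⟨h, b, r, e⟩ := ih
    refine ⟨?_, !x.2, _, by simp [List.replicate_succ]; rfl⟩
    rw [List.replicate_succ, List.flatten_cons, List.append_assoc, e]
    rw [e] at h
    exact List.isChain_cons_cons.2 ⟨fun h' => absurd h'.symm ha,
      List.isChain_cons_cons.2 ⟨fun h' => absurd h' ha, h⟩⟩

theorem mk_flatten_replicate (y : List (α × Bool)) (k : ℕ) :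
    mk (List.replicate k y).flatten = mk y ^ k := by
  induction k with
  | zero => rfl
  | succ k ih => rw [List.replicate_succ, List.flatten_cons, ← mul_mk, ih, pow_succ']

variable [DecidableEq α] {C : Subgroup (FreeGroup α)} {Q : Set (FreeGroup α)}

/-- Suppose all reduced left extensions of `w = x :: t` stay in `Q`. With `y = x⁻¹ a`, two of the
words `y ^ k w` share a coset, so `w⁻¹ y ^ (k + 1) w ∈ C` for some `k`. Inserting `y ^ (k + 1)` then
removes any cancellation between `u` and `w` without changing the coset of `u w`, and `Q` is
everything. -/
theorem exists_extension_notMem (hQC : ∀ g ∈ Q, ∀ c ∈ C, g * c ∈ Q)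
    (hfin : ((fun g : FreeGroup α => (g : FreeGroup α ⧸ C)) '' Q).Finite) (hQ : Q ≠ Set.univ)
    {x : α × Bool} {t : List (α × Bool)} (hw : FreeGroup.IsReduced (x :: t)) {a : α}
    (ha : a ≠ x.1) :
    ∃ v, FreeGroup.IsReduced (v ++ x :: t) ∧ mk (v ++ x :: t) ∉ Q := by
  by_contra! H
  set y : List (α × Bool) := [(x.1, !x.2), (a, true)] with hy
  have hmem : ∀ k, mk y ^ k * mk (x :: t) ∈ Q := fun k => by
    have := H _ (isReduced_alternating hw ha k).1
    rwa [← mul_mk, mk_flatten_replicate] at this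
  obtain ⟨i, j, hlt, hij⟩ : ∃ i j : ℕ, i < j ∧
      ((mk y ^ i * mk (x :: t) : FreeGroup α) : FreeGroup α ⧸ C) =
      ((mk y ^ j * mk (x :: t) : FreeGroup α) : FreeGroup α ⧸ C) := by
    obtain ⟨i, -, j, -, hne, hij⟩ := Set.infinite_univ.exists_ne_map_eq_of_mapsTo
      (f := fun k : ℕ => ((mk y ^ k * mk (x :: t) : FreeGroup α) : FreeGroup α ⧸ C))
      (t := (fun g : FreeGroup α => (g : FreeGroup α ⧸ C)) '' Q)
      (fun k _ => Set.mem_image_of_mem _ (hmem k)) hfin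
    rcases lt_or_gt_of_ne hne with h | h
    · exact ⟨i, j, h, hij⟩
    · exact ⟨j, i, h, hij.symm⟩
  obtain ⟨k, rfl⟩ : ∃ k, j = i + (k + 1) := ⟨j - i - 1, by omega⟩
  have hc : (mk (x :: t))⁻¹ * mk y ^ (k + 1) * mk (x :: t) ∈ C := by
    have := QuotientGroup.eq.1 hij
    rw [pow_add] at this
    convert this using 1
    group
  apply hQ
  rw [Set.eq_univ_iff_forall]
  have key : ∀ u, FreeGroup.IsReduced u → mk u * mk (x :: t) ∈ Q := by
    intro u hu
    rcases isReduced_append_or hu hw with h | ⟨b, z, r, rfl, h2⟩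
    · rw [mul_mk]; exact H _ h
    · obtain ⟨rfl, -⟩ : x = (z.1, !z.2) ∧ _ := by simpa using h2
      -- Here `u` ends in `x⁻¹`, the very letter with which `y ^ (k + 1)` begins, so these do not
      -- cancel.
      rcases isReduced_append_or hu (isReduced_alternating hw ha (k + 1)).1 with
        h | ⟨b', z', r', h3, h4⟩
      · rw [← List.append_assoc] at h
        have := hQC _ (H _ h) _ (C.inv_mem hc)
        rw [← mul_mk, ← mul_mk, mk_flatten_replicate] at this
        change mk (b ++ [z]) * mk y ^ (k + 1) * _ * _ ∈ Q at this
        convert this using 1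
        group
      · exfalso
        obtain rfl : z = z' := by simpa using (List.append_inj' h3 rfl).2
        simp only [List.replicate_succ, List.flatten_cons, List.cons_append, Bool.not_not,
          Prod.mk.eta] at h4
        have h5 := congrArg Prod.snd (List.cons.inj h4).1
        simp at h5
  intro g
  have := key _ (isReduced_toWord (x := g * (mk (x :: t))⁻¹))
  rwa [mk_toWord, inv_mul_cancel_right] at this

/-- Whether `v` works depends only on the first letter of `w` and its left coset, and only finitely
many such pairs occur. -/
theorem exists_extension_length_bound [Finite α] [Nontrivial α]
    (hQC : ∀ g ∈ Q, ∀ c ∈ C, g * c ∈ Q)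
    (hfin : ((fun g : FreeGroup α => (g : FreeGroup α ⧸ C)) '' Q).Finite) (hQ : Q ≠ Set.univ) :
    ∃ L : ℕ, ∀ w, w ≠ [] → FreeGroup.IsReduced w → mk w ∈ Q →
      ∃ v, v.length ≤ L ∧ FreeGroup.IsReduced (v ++ w) ∧ mk (v ++ w) ∉ Q := by
  set key : List (α × Bool) → Option (α × Bool) × (FreeGroup α ⧸ C) :=
    fun w => (w.head?, (mk w : FreeGroup α)) with hkey
  have hK : (key '' {w | mk w ∈ Q}).Finite := by
    refine (Set.finite_univ.prod hfin).subset ?_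
    rintro _ ⟨w, hw, rfl⟩
    exact ⟨trivial, _, hw, rfl⟩
  have h1 : ∀ k, ∃ n, ∀ w, w ≠ [] → FreeGroup.IsReduced w → key w = k →
      ∃ v, v.length ≤ n ∧ FreeGroup.IsReduced (v ++ w) ∧ mk (v ++ w) ∉ Q := by
    intro k
    by_cases hk : ∃ w, w ≠ [] ∧ FreeGroup.IsReduced w ∧ key w = k
    · obtain ⟨w, hw0, hw, rfl⟩ := hk
      obtain ⟨x, t, rfl⟩ := List.exists_cons_of_ne_nil hw0
      obtain ⟨a, ha⟩ := exists_ne x.1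
      obtain ⟨v, hv, hvQ⟩ := exists_extension_notMem hQC hfin hQ hw ha
      refine ⟨v.length, fun w' _ hw' e => ⟨v, le_rfl, ?_, fun h => hvQ ?_⟩⟩
      · exact isReduced_append_of_head?_eq hv hw' (congrArg Prod.fst e).symm
      · have := hQC _ h _ (QuotientGroup.eq.1 (congrArg Prod.snd e))
        rw [← mul_mk] at this ⊢
        simpa [mul_assoc, -mul_mk, -inv_mk] using this
    · exact ⟨0, fun w h0 hw e => absurd ⟨w, h0, hw, e⟩ hk⟩
  choose n hn using h1
  refine ⟨hK.toFinset.sup n, fun w h0 hw hwQ => ?_⟩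
  obtain ⟨v, hv, h⟩ := hn _ w h0 hw rfl
  exact ⟨v, hv.trans (Finset.le_sup (f := n) (hK.mem_toFinset.2 ⟨w, hwQ, rfl⟩)), h⟩

end FreeGroupDensity

/-! ### Counting reduced words with a transfer operator -/

namespace FreeGroupDensity

open FreeGroup

variable {α : Type*}

open Classical in
/-- The indicator function of the words representing an element of `Q`. -/
noncomputable def wordIndicator (Q : Set (FreeGroup α)) (w : List (α × Bool)) : ℕ :=
  if mk w ∈ Q then 1 else 0

theorem wordIndicator_le_one (Q : Set (FreeGroup α)) (w : List (α × Bool)) :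
    wordIndicator Q w ≤ 1 := by
  unfold wordIndicator; split_ifs <;> simp

variable [Fintype α]

open Classical in
/-- The letters that can be put in front of `w` without cancellation. -/
noncomputable def nextLetters (w : List (α × Bool)) : Finset (α × Bool) :=
  Finset.univ.filter fun x => FreeGroup.IsReduced (x :: w)

/-- The transfer operator: sum a weight over all reduced one-letter extensions of a word. -/
noncomputable def transfer (f : List (α × Bool) → ℕ) (w : List (α × Bool)) : ℕ :=
  ∑ x ∈ nextLetters w, f (x :: w)

open Classical in
/-- The reduced words of length `n`. -/
noncomputable def reducedWords (α : Type*) [Fintype α] : ℕ → Finset (List (α × Bool))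
  | 0 => {[]}
  | n + 1 => (reducedWords α n).biUnion fun w => (nextLetters w).image (· :: w)

theorem mem_nextLetters {w : List (α × Bool)} {x : α × Bool} :
    x ∈ nextLetters w ↔ FreeGroup.IsReduced (x :: w) := by
  simp [nextLetters]

theorem mem_reducedWords {n : ℕ} {w : List (α × Bool)} :
    w ∈ reducedWords α n ↔ FreeGroup.IsReduced w ∧ w.length = n := by
  induction n generalizing w with
  | zero =>
    simp only [reducedWords, Finset.mem_singleton, List.length_eq_zero_iff]
    exact ⟨fun h => ⟨h ▸ IsReduced.nil, h⟩, fun h => h.2⟩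
  | succ n ih =>
    simp only [reducedWords, Finset.mem_biUnion, Finset.mem_image, mem_nextLetters, ih]
    constructor
    · rintro ⟨v, ⟨hv, hl⟩, x, hx, rfl⟩
      exact ⟨hx, by simp [hl]⟩
    · rintro ⟨h, hl⟩
      obtain ⟨x, v, rfl⟩ := List.exists_cons_of_length_eq_add_one hl
      exact ⟨v, ⟨h.infix ⟨[x], [], by simp⟩, by simpa using hl⟩, x, h, rfl⟩

theorem sum_reducedWords_succ (n : ℕ) (f : List (α × Bool) → ℕ) :
    ∑ w ∈ reducedWords α (n + 1), f w = ∑ w ∈ reducedWords α n, transfer f w := by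
  classical
  simp only [reducedWords]
  rw [Finset.sum_biUnion]
  · refine Finset.sum_congr rfl fun w _ => ?_
    rw [transfer, Finset.sum_image]
    intro x _ y _ h
    exact (List.cons.inj h).1
  · intro v _ w _ hne
    refine Finset.disjoint_left.2 fun z hz hz' => hne ?_
    obtain ⟨x, -, rfl⟩ := Finset.mem_image.1 hz
    obtain ⟨y, -, h⟩ := Finset.mem_image.1 hz'
    exact (List.cons.inj h).2.symm

theorem sum_reducedWords_add (n l : ℕ) (f : List (α × Bool) → ℕ) :
    ∑ w ∈ reducedWords α (n + l), f w = ∑ w ∈ reducedWords α n, transfer^[l] f w := by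
  induction l generalizing f with
  | zero => rfl
  | succ l ih => rw [← add_assoc, sum_reducedWords_succ, ih, Function.iterate_succ_apply]

theorem card_nextLetters_cons {x : α × Bool} {t : List (α × Bool)}
    (h : FreeGroup.IsReduced (x :: t)) :
    (nextLetters (x :: t)).card = 2 * Fintype.card α - 1 := by
  classical
  have : nextLetters (x :: t) = Finset.univ.erase (x.1, !x.2) := by
    ext ⟨y1, y2⟩
    simp only [mem_nextLetters, Finset.mem_erase, Finset.mem_univ, and_true, ne_eq]
    rw [FreeGroup.IsReduced, List.isChain_cons_cons]
    obtain ⟨x1, x2⟩ := x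
    have h' : List.IsChain (fun a b : α × Bool => a.1 = b.1 → a.2 = b.2) ((x1, x2) :: t) := h
    simp only [h', and_true, Prod.mk.injEq, not_and]
    cases x2 <;> cases y2 <;> simp
  rw [this, Finset.card_erase_of_mem (Finset.mem_univ _), Finset.card_univ, Fintype.card_prod,
    Fintype.card_bool, mul_comm]

theorem card_nextLetters_nil :
    (nextLetters ([] : List (α × Bool))).card = 2 * Fintype.card α := by
  have : nextLetters ([] : List (α × Bool)) = Finset.univ := by
    ext x
    simp [mem_nextLetters]
  rw [this, Finset.card_univ, Fintype.card_prod, Fintype.card_bool, mul_comm]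

theorem pow_le_card_reducedWords (n : ℕ) :
    (2 * Fintype.card α - 1) ^ n ≤ (reducedWords α n).card := by
  induction n with
  | zero => simp [reducedWords]
  | succ n ih =>
    rw [Finset.card_eq_sum_ones, sum_reducedWords_succ, pow_succ]
    calc _ ≤ (reducedWords α n).card * (2 * Fintype.card α - 1) := Nat.mul_le_mul_right _ ih
      _ ≤ _ := by
        rw [← smul_eq_mul]
        refine Finset.card_nsmul_le_sum _ _ _ fun w hw => ?_
        rw [transfer, ← Finset.card_eq_sum_ones]
        cases w with
        | nil => rw [card_nextLetters_nil]; omega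
        | cons x t => rw [card_nextLetters_cons (mem_reducedWords.1 hw).1]

/-- Dropping discards the prepended letters, and each step multiplies the number of extensions by `2
* Fintype.card α - 1`. The offset `j` makes the induction go through. -/
theorem transfer_iterate_drop_le (h : List (α × Bool) → ℕ) (i : ℕ) :
    ∀ (j : ℕ) {w : List (α × Bool)}, w ≠ [] → FreeGroup.IsReduced w →
      transfer^[i] (fun v => h (v.drop (i + j))) w ≤
        (2 * Fintype.card α - 1) ^ i * h (w.drop j) := by
  induction i with
  | zero => intro j w _ _; simp
  | succ i ih =>
    intro j w h0 hw
    rw [Function.iterate_succ_apply']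
    obtain ⟨y, t, rfl⟩ := List.exists_cons_of_ne_nil h0
    calc transfer _ (y :: t)
        ≤ ∑ x ∈ nextLetters (y :: t), (2 * Fintype.card α - 1) ^ i * h ((y :: t).drop j) := by
          refine Finset.sum_le_sum fun x hx => ?_
          have := ih (j + 1) (w := x :: y :: t) (by simp) (mem_nextLetters.1 hx)
          rw [List.drop_succ_cons] at this
          rwa [show i + 1 + j = i + (j + 1) by ring]
      _ = _ := by
          rw [Finset.sum_const, card_nextLetters_cons hw, smul_eq_mul]
          ring

variable {Q : Set (FreeGroup α)}

theorem transfer_mono {f g : List (α × Bool) → ℕ} (h : f ≤ g) : transfer f ≤ transfer g :=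
  fun _ => Finset.sum_le_sum fun _ _ => h _

theorem transfer_iterate_wordIndicator_le (n : ℕ) {w : List (α × Bool)} (h0 : w ≠ [])
    (hw : FreeGroup.IsReduced w) :
    transfer^[n] (wordIndicator Q) w ≤ (2 * Fintype.card α - 1) ^ n := by
  have h1 : transfer^[n] (wordIndicator Q) ≤ transfer^[n] fun _ => 1 :=
    Monotone.iterate (fun _ _ h => transfer_mono h) n (wordIndicator_le_one Q)
  simpa using (h1 w).trans (transfer_iterate_drop_le (fun _ => 1) n 0 h0 hw)

theorem transfer_iterate_wordIndicator_of_notMem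
    (hsuf : ∀ x w, FreeGroup.IsReduced (x :: w) → mk (x :: w) ∈ Q → mk w ∈ Q) (n : ℕ) :
    ∀ {w : List (α × Bool)}, mk w ∉ Q → transfer^[n] (wordIndicator Q) w = 0 := by
  induction n with
  | zero => intro w h; simp [wordIndicator, h]
  | succ n ih =>
    intro w h
    rw [Function.iterate_succ_apply']
    exact Finset.sum_eq_zero fun x hx => ih fun h' => h (hsuf _ _ (mem_nextLetters.1 hx) h')

/-- Following `v` letter by letter, one summand at each level is strictly below its bound; once
outside `Q`, suffix closure keeps all further extensions outside. -/
theorem transfer_iterate_wordIndicator_lt (hα : 0 < Fintype.card α)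
    (hsuf : ∀ x w, FreeGroup.IsReduced (x :: w) → mk (x :: w) ∈ Q → mk w ∈ Q)
    (v : List (α × Bool)) :
    ∀ {w : List (α × Bool)} (n : ℕ), w ≠ [] → v.length ≤ n → FreeGroup.IsReduced (v ++ w) →
      mk (v ++ w) ∉ Q →
      transfer^[n] (wordIndicator Q) w < (2 * Fintype.card α - 1) ^ n := by
  induction v using List.reverseRecOn with
  | nil =>
    intro w n _ _ _ hQ
    rw [List.nil_append] at hQ
    rw [transfer_iterate_wordIndicator_of_notMem hsuf n hQ]
    exact Nat.pow_pos (by omega)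
  | append_singleton v x ih =>
    intro w n h0 hl hr hQ
    rw [List.append_assoc, List.singleton_append] at hr hQ
    obtain ⟨n, rfl⟩ : ∃ k, n = k + 1 := ⟨n - 1, by simp at hl; omega⟩
    have hx : FreeGroup.IsReduced (x :: w) := hr.infix ⟨v, [], by simp⟩
    obtain ⟨y, t, rfl⟩ := List.exists_cons_of_ne_nil h0
    rw [Function.iterate_succ_apply']
    calc transfer _ (y :: t)
        < ∑ z ∈ nextLetters (y :: t), (2 * Fintype.card α - 1) ^ n := by
          refine Finset.sum_lt_sum (fun z hz => ?_) ⟨x, mem_nextLetters.2 hx, ?_⟩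
          · exact transfer_iterate_wordIndicator_le n (by simp) (mem_nextLetters.1 hz)
          · exact ih n (by simp) (by simpa using hl) hr hQ
      _ = _ := by
          rw [Finset.sum_const, card_nextLetters_cons (hx.infix ⟨[x], [], by simp⟩), smul_eq_mul]
          ring

/-- Each word in `Q` loses at least one of its extensions by `L` letters, and words outside `Q`
contribute none. The empty word is excluded since it has one more one-letter extension than the
others. -/
theorem sum_wordIndicator_add_le (hα : 0 < Fintype.card α)
    (hsuf : ∀ x w, FreeGroup.IsReduced (x :: w) → mk (x :: w) ∈ Q → mk w ∈ Q) {L : ℕ}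
    (hL : ∀ w, w ≠ [] → FreeGroup.IsReduced w → mk w ∈ Q →
      ∃ v, v.length ≤ L ∧ FreeGroup.IsReduced (v ++ w) ∧ mk (v ++ w) ∉ Q) {n : ℕ} (hn : 0 < n) :
    ∑ w ∈ reducedWords α (n + L), wordIndicator Q w + ∑ w ∈ reducedWords α n, wordIndicator Q w ≤
      (2 * Fintype.card α - 1) ^ L * ∑ w ∈ reducedWords α n, wordIndicator Q w := by
  rw [sum_reducedWords_add, ← Finset.sum_add_distrib, Finset.mul_sum]
  refine Finset.sum_le_sum fun w hw => ?_
  obtain ⟨hr, hl⟩ := mem_reducedWords.1 hw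
  have h0 : w ≠ [] := by rintro rfl; simp at hl; omega
  by_cases hQ : mk w ∈ Q
  · obtain ⟨v, h1, h2, h3⟩ := hL w h0 hr hQ
    have := transfer_iterate_wordIndicator_lt hα hsuf v L h0 h1 h2 h3
    simp only [wordIndicator, hQ, if_true, mul_one] at this ⊢
    exact this
  · rw [transfer_iterate_wordIndicator_of_notMem hsuf L hQ]
    simp [wordIndicator, hQ]

theorem sum_exists_drop_le {m k : ℕ} (hk : m ≤ k) :
    ∑ w ∈ reducedWords α k, (∑ i ∈ Finset.range m, wordIndicator Q (w.drop i)) ≤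
      ∑ i ∈ Finset.range m, (2 * Fintype.card α - 1) ^ i *
        ∑ w ∈ reducedWords α (k - i), wordIndicator Q w := by
  rw [Finset.sum_comm]
  refine Finset.sum_le_sum fun i hi => ?_
  have hik : i < m := Finset.mem_range.1 hi
  conv_lhs => rw [← Nat.sub_add_cancel (show i ≤ k by omega), sum_reducedWords_add]
  rw [Finset.mul_sum]
  refine Finset.sum_le_sum fun w hw => ?_
  obtain ⟨hr, hl⟩ := mem_reducedWords.1 hw
  have h0 : w ≠ [] := by rintro rfl; simp at hl; omega
  simpa using transfer_iterate_drop_le (wordIndicator Q) i 0 h0 hr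

variable [DecidableEq α]

open Classical in
theorem ncard_inter_sphere (R : Set (FreeGroup α)) (k : ℕ) :
    (R ∩ sphere α k).ncard = ((reducedWords α k).filter fun w => mk w ∈ R).card := by
  rw [← Set.ncard_coe_finset]
  refine (Set.ncard_congr (fun w _ => mk w) ?_ ?_ ?_).symm
  · intro w hw
    simp only [Finset.coe_filter, Set.mem_ofPred_eq, mem_reducedWords] at hw
    refine ⟨hw.2, ?_⟩
    change (mk w).toWord.length = k
    rw [toWord_mk_of_isReduced hw.1.1, hw.1.2]
  · intro v w hv hw h
    simp only [Finset.coe_filter, Set.mem_ofPred_eq, mem_reducedWords] at hv hw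
    rw [← toWord_mk_of_isReduced hv.1.1, h, toWord_mk_of_isReduced hw.1.1]
  · rintro g ⟨hg, hk⟩
    refine ⟨g.toWord, ?_, mk_toWord⟩
    simp only [Finset.coe_filter, Set.mem_ofPred_eq, mem_reducedWords, mk_toWord]
    exact ⟨⟨isReduced_toWord, hk⟩, hg⟩

theorem pow_le_ncard_sphere (k : ℕ) :
    (2 * Fintype.card α - 1) ^ k ≤ (sphere α k).ncard := by
  classical
  have := ncard_inter_sphere (Set.univ : Set (FreeGroup α)) k
  rw [Set.univ_inter] at this
  rw [this]
  simpa using pow_le_card_reducedWords (α := α) k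

end FreeGroupDensity

/-! ### Exponential decay and the main estimate -/

namespace FreeGroupDensity

open FreeGroup

theorem exists_geometric_bound {b : ℕ → ℝ} (hb : ∀ n, 0 ≤ b n) {θ : ℝ} (h0 : 0 < θ) (h1 : θ < 1)
    {L : ℕ} (hL : 0 < L) (h : ∀ n, 0 < n → b (n + L) ≤ θ * b n) :
    ∃ K ρ : ℝ, 0 ≤ K ∧ 0 < ρ ∧ ρ < 1 ∧ ∀ n, b n ≤ K * ρ ^ n := by
  set ρ : ℝ := θ ^ ((L : ℝ)⁻¹) with hρ
  have hρ0 : 0 < ρ := Real.rpow_pos_of_pos h0 _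
  have hρ1 : ρ < 1 := Real.rpow_lt_one h0.le h1 (by positivity)
  have hρL : ρ ^ L = θ := Real.rpow_inv_natCast_pow h0.le hL.ne'
  -- The constant absorbs the values up to `n = L`, since the recursion starts only at positive
  -- arguments.
  refine ⟨∑ n ∈ Finset.range (L + 1), b n / ρ ^ n, ρ,
    Finset.sum_nonneg fun n _ => div_nonneg (hb n) (by positivity), hρ0, hρ1, fun n => ?_⟩
  induction n using Nat.strong_induction_on with
  | _ n ih =>
    by_cases hn : n < L + 1
    · rw [← div_le_iff₀ (by positivity)]
      exact Finset.single_le_sum (f := fun n => b n / ρ ^ n)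
        (fun n _ => div_nonneg (hb n) (by positivity)) (Finset.mem_range.2 hn)
    · obtain ⟨k, rfl⟩ : ∃ k, n = k + L := ⟨n - L, by omega⟩
      calc b (k + L) ≤ θ * b k := h k (by omega)
        _ ≤ θ * _ := mul_le_mul_of_nonneg_left (ih k (by omega)) h0.le
        _ = _ := by rw [pow_add, hρL]; ring

/-- Any `δ` strictly between `ρ` and `1` eventually absorbs the constant `K`. -/
theorem exists_pow_bound {f : ℕ → ℝ} {K ρ : ℝ} (h0 : 0 < ρ) (h1 : ρ < 1) {N : ℕ}
    (h : ∀ k ≥ N, f k ≤ K * ρ ^ k) :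
    ∃ δ : ℝ, 0 < δ ∧ δ < 1 ∧ ∃ N : ℕ, ∀ k ≥ N, f k < δ ^ k := by
  obtain ⟨δ, hδ, hδ1⟩ := exists_between h1
  have hδ0 : 0 < δ := h0.trans hδ
  have ht : Filter.Tendsto (fun k : ℕ => K * (ρ / δ) ^ k) Filter.atTop (nhds (K * 0)) :=
    (tendsto_pow_atTop_nhds_zero_of_lt_one (by positivity) ((div_lt_one hδ0).2 hδ)).const_mul K
  rw [mul_zero] at ht
  obtain ⟨M, hM⟩ := Filter.eventually_atTop.1 (ht.eventually_lt_const zero_lt_one)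
  refine ⟨δ, hδ0, hδ1, max N M, fun k hk => (h k (le_of_max_le_left hk)).trans_lt ?_⟩
  have := hM k (le_of_max_le_right hk)
  rwa [div_pow, ← mul_div_assoc, div_lt_one (by positivity)] at this

theorem finiteIndex_of_subsingleton {α : Type*} [Subsingleton α] {C : Subgroup (FreeGroup α)}
     (hC : C ≠ ⊥) : C.FiniteIndex := by
  obtain ⟨⟨c, hc⟩, hc1⟩ := Subgroup.ne_bot_iff_exists_ne_one.1 hC
  have hc0 : c ≠ 1 := fun h => hc1 (Subtype.ext h)
  rcases isEmpty_or_nonempty α with hα | ⟨⟨a⟩⟩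
  · exact absurd (Subsingleton.elim c 1) hc0
  have hgen : ∀ g : FreeGroup α, ∃ n : ℤ, of a ^ n = g := by
    intro g
    have hr : Set.range (of : α → FreeGroup α) = {of a} := by
      ext z
      simp only [Set.mem_range, Set.mem_singleton_iff]
      exact ⟨fun ⟨b, hb⟩ => by rw [← hb, Subsingleton.elim b a], fun h => ⟨a, h.symm⟩⟩
    have : g ∈ Subgroup.closure (Set.range (of : α → FreeGroup α)) := by
      rw [closure_range_of]; trivial
    rw [hr, ← Subgroup.zpowers_eq_closure] at this
    exact this
  obtain ⟨n, rfl⟩ := hgen c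
  have hn : n ≠ 0 := by rintro rfl; simp at hc0
  have : Finite (FreeGroup α ⧸ C) := by
    rw [← Set.finite_univ_iff]
    refine ((Set.finite_Icc 0 |n|).image
      fun k : ℤ => ((of a ^ k : FreeGroup α) : FreeGroup α ⧸ C)).subset fun z _ => ?_
    obtain ⟨g, rfl⟩ := QuotientGroup.mk_surjective z
    obtain ⟨k, rfl⟩ := hgen g
    refine ⟨k % n, ⟨Int.emod_nonneg k hn, (Int.emod_lt_abs k hn).le⟩, ?_⟩
    refine QuotientGroup.eq.2 ?_
    have e : (of a ^ (k % n))⁻¹ * of a ^ k = (of a ^ n) ^ (k / n) := by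
      rw [← zpow_neg, ← zpow_add, ← zpow_mul]
      congr 1
      have := Int.emod_add_mul_ediv k n
      linarith
    rw [e]
    exact C.zpow_mem hc _
  exact Subgroup.finiteIndex_of_finite_quotient

variable {α : Type*} [DecidableEq α] {C : Subgroup (FreeGroup α)}

theorem inv_mk_mem_corePrefixes_of_cons {x : α × Bool} {w : List (α × Bool)}
    (hr : FreeGroup.IsReduced (x :: w)) (h : (mk (x :: w))⁻¹ ∈ corePrefixes C) :
    (mk w)⁻¹ ∈ corePrefixes C := by
  rw [inv_mk]
  refine mk_mem_corePrefixes_of_prefix h ?_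
  rw [toWord_inv, toWord_mk_of_isReduced hr, invRev_cons]
  exact List.prefix_append _ _

theorem corePrefixes_ne_univ (hC : C.FG) (hindex : ¬ C.FiniteIndex) :
    corePrefixes C ≠ Set.univ := by
  intro h
  apply hindex
  have hfin := finite_cosets_corePrefixes hC
  rw [h] at hfin
  have : Finite (FreeGroup α ⧸ C) := by
    rw [← Set.finite_univ_iff]
    refine hfin.subset fun z _ => ?_
    obtain ⟨g, rfl⟩ := QuotientGroup.mk_surjective z
    exact ⟨g⁻¹, trivial, by simp⟩
  exact Subgroup.finiteIndex_of_finite_quotient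

/-- A union bound over the `m` possible lengths of the short prefix. -/
theorem ncard_shortTimesCore_le [Fintype α] {R : Set (FreeGroup α)} {m : ℕ}
    (hR : R ⊆ shortTimesCore C m) (k : ℕ) :
    (R ∩ sphere α k).ncard ≤ ∑ w ∈ reducedWords α k,
      ∑ i ∈ Finset.range m, wordIndicator {g | g⁻¹ ∈ corePrefixes C} (w.drop i) := by
  classical
  rw [ncard_inter_sphere, Finset.card_filter]
  refine Finset.sum_le_sum fun w hw => ?_
  split_ifs with h
  · obtain ⟨p, q, hw', hp, hq⟩ := hR h
    rw [toWord_mk_of_isReduced (mem_reducedWords.1 hw).1] at hw'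
    refine le_trans ?_ (Finset.single_le_sum (f := fun i => wordIndicator _ (w.drop i))
      (fun _ _ => Nat.zero_le _) (Finset.mem_range.2 hp))
    simp only [hw', List.drop_left]
    exact (if_pos hq).ge
  · exact Nat.zero_le _

theorem exponentiallyNegligible_of_subset_shortTimesCore [Fintype α] [Nontrivial α] (hC : C.FG)
    (hindex : ¬ C.FiniteIndex) {R : Set (FreeGroup α)} {m : ℕ} (hR : R ⊆ shortTimesCore C m) :
    ExponentiallyNegligible R := by
  set Q : Set (FreeGroup α) := {g | g⁻¹ ∈ corePrefixes C} with hQ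
  have hQC : ∀ g ∈ Q, ∀ c ∈ C, g * c ∈ Q := fun g hg c hc => by
    simpa [hQ] using mul_mem_corePrefixes (C.inv_mem hc) hg
  have hfin : ((fun g : FreeGroup α => (g : FreeGroup α ⧸ C)) '' Q).Finite := by
    refine (finite_cosets_corePrefixes hC).subset ?_
    rintro _ ⟨g, hg, rfl⟩
    exact ⟨g⁻¹, hg, by simp⟩
  have hQ1 : Q ≠ Set.univ := fun h => corePrefixes_ne_univ hC hindex <| by
    rw [Set.eq_univ_iff_forall] at h ⊢
    intro g
    simpa [hQ] using h g⁻¹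
  obtain ⟨L, hL⟩ := exists_extension_length_bound hQC hfin hQ1
  set q : ℕ := 2 * Fintype.card α - 1 with hq
  have hα : 1 < Fintype.card α := Fintype.one_lt_card
  have hq3 : 1 < q := by omega
  have hqpos : (0 : ℝ) < q := by exact_mod_cast (by omega : 0 < q)
  set A : ℕ → ℕ := fun n => ∑ w ∈ reducedWords α n, wordIndicator Q w with hA
  -- Using `L + 1` in place of `L` keeps the step positive even when `L = 0`.
  have hstep : ∀ n, 0 < n → A (n + (L + 1)) + A n ≤ q ^ (L + 1) * A n := fun n hn =>
    sum_wordIndicator_add_le (by omega) (fun x w => inv_mk_mem_corePrefixes_of_cons)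
      (fun w h0 hr hw => (hL w h0 hr hw).imp fun v h => ⟨h.1.trans (Nat.le_succ L), h.2⟩) hn
  have hqL : (1 : ℝ) < (q : ℝ) ^ (L + 1) := by exact_mod_cast Nat.one_lt_pow (Nat.succ_ne_zero L) hq3
  obtain ⟨K, ρ, hK, hρ0, hρ1, hb⟩ := exists_geometric_bound (b := fun n => (A n : ℝ) / q ^ n)
    (fun n => by positivity) (θ := 1 - ((q : ℝ) ^ (L + 1))⁻¹)
    (by have := inv_lt_one_of_one_lt₀ hqL; linarith)
    (by have : 0 < ((q : ℝ) ^ (L + 1))⁻¹ := by positivity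
        linarith) (Nat.succ_pos L) (fun n hn => by
      have h : (A (n + (L + 1)) : ℝ) + A n ≤ q ^ (L + 1) * A n := by exact_mod_cast hstep n hn
      rw [div_le_iff₀ (by positivity)]
      have e : (1 - ((q : ℝ) ^ (L + 1))⁻¹) * (A n / q ^ n) * q ^ (n + (L + 1)) =
          q ^ (L + 1) * A n - A n := by
        rw [pow_add]
        field_simp
        ring
      rw [Nat.succ_eq_add_one, e]
      linarith)
  -- Each of the `m` cut positions `i < m` contributes at most `K * ρ ^ (k - i)`, which is at most
  -- `K * ρ ^ k / ρ ^ m`.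
  refine exists_pow_bound (K := m * K / ρ ^ m) hρ0 hρ1 (N := m) fun k hk => ?_
  have h1 : ((R ∩ sphere α k).ncard : ℝ) ≤ ∑ i ∈ Finset.range m, (q : ℝ) ^ i * A (k - i) := by
    exact_mod_cast (ncard_shortTimesCore_le hR k).trans (sum_exists_drop_le hk)
  have h2 : (q : ℝ) ^ k ≤ (sphere α k).ncard := by exact_mod_cast pow_le_ncard_sphere (α := α) k
  calc frequency R k ≤ (∑ i ∈ Finset.range m, (q : ℝ) ^ i * A (k - i)) / q ^ k :=
        div_le_div₀ (by positivity) h1 (by positivity) h2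
    _ = ∑ i ∈ Finset.range m, (A (k - i) : ℝ) / q ^ (k - i) := by
        rw [Finset.sum_div]
        refine Finset.sum_congr rfl fun i hi => ?_
        have hik : i ≤ k := (Finset.mem_range.1 hi).le.trans hk
        rw [← Nat.add_sub_cancel' hik, pow_add, Nat.add_sub_cancel_left]
        field_simp
    _ ≤ ∑ i ∈ Finset.range m, K * ρ ^ k / ρ ^ m := by
        refine Finset.sum_le_sum fun i hi => (hb (k - i)).trans ?_
        rw [mul_div_assoc]
        refine mul_le_mul_of_nonneg_left ?_ hK
        rw [le_div_iff₀ (by positivity), ← pow_add]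
        exact pow_le_pow_of_le_one hρ0.le hρ1.le (by have := Finset.mem_range.1 hi; omega)
    _ = m * K / ρ ^ m * ρ ^ k := by
        rw [Finset.sum_const, Finset.card_range, nsmul_eq_mul]
        ring

theorem exponentiallyNegligible_empty : ExponentiallyNegligible (∅ : Set (FreeGroup α)) :=
  ⟨1 / 2, by norm_num, by norm_num, 0, fun k _ => by simp [frequency]⟩

theorem sin_bot : Sin (⊥ : Subgroup (FreeGroup α)) = ∅ := by
  simp [Sin, singularPart, generalizedNormalizer]

theorem uns_bot : Uns (⊥ : Subgroup (FreeGroup α)) = ∅ := by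
  simp +contextual [Uns, unstablePart, stablePart]

end FreeGroupDensity

theorem mainTheorem4 {α : Type*} [Fintype α] [DecidableEq α]
    (C : Subgroup (FreeGroup α)) (hfg : C.FG) (hindex : ¬ C.FiniteIndex) :
    FreeGroupDensity.ExponentiallyNegligible (FreeGroupDensity.Sin C) ∧
      FreeGroupDensity.ExponentiallyNegligible (FreeGroupDensity.Uns C) := by
  open FreeGroupDensity in
  rcases subsingleton_or_nontrivial α with hα | hα
  -- In rank at most one, infinite index forces `C` to be trivial, and both sets are empty.
  · obtain rfl : C = ⊥ := by
      by_contra h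
      exact hindex (finiteIndex_of_subsingleton h)
    rw [sin_bot, uns_bot]
    exact ⟨exponentiallyNegligible_empty, exponentiallyNegligible_empty⟩
  · obtain ⟨m, hm⟩ := exists_union_subset_shortTimesCore hfg
    exact ⟨exponentiallyNegligible_of_subset_shortTimesCore hfg hindex
        (Set.subset_union_left.trans hm),
      exponentiallyNegligible_of_subset_shortTimesCore hfg hindex
        (Set.subset_union_right.trans hm)⟩
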